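/- Let $n\ge 3$, let $\mu\in[1/2,1)$, and let $r_1\ge r_2\ge\cdots\ge r_n>0$. In the heterogeneous Deffuant--Weisbuch (DW) model, agents $1,\dots,n$ hold opinions $x(t)=(x_1(t),\dots,x_n(t))\in\mathbb{R}^n$ at times $t=0,1,2,\dots$. At each time $t$ a pair $\{i_t,j_t\}$ is selected, independently over time (and independently of $x(0)$ if $x(0)$ is random) and uniformly from the set of all pairs $\{i,j\}$ with $1\le i<j\le n$, and the opinions are updated by $$x_{i_t}(t+1)=x_{i_t}(t)+\mu\,\mathbf{1}_{\{|x_{j_t}(t)-x_{i_t}(t)|\le r_{i_t}\}}\,(x_{j_t}(t)-x_{i_t}(t)),$$ $$x_{j_t}(t+1)=x_{j_t}(t)+\mu\,\mathbf{1}_{\{|x_{j_t}(t)-x_{i_t}(t)|\le r_{j_t}\}}\,(x_{i_t}(t)-x_{j_t}(t)),$$ and $x_k(t+1)=x_k(t)$ for all $k\notin\{i_t,j_t\}$. If the largest confidence bound satisfies $r_1\ge 1$, then for every initial state $x(0)\in[0,1]^n$, deterministic or random, the system reaches consensus almost surely, that is, almost surely there is a real number $c$ such that $x_i(t)\to c$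 as $t\to\infty$ for every $i\in\{1,\dots,n\}$. -/

import Mathlib

namespace DW

open MeasureTheory ProbabilityTheory Filter Topology

/-- The set of all pairs `{i, j}` of distinct agents, each written with `i < j`. -/
abbrev AgentPair (n : ℕ) : Type := {p : Fin n × Fin n // p.1 < p.2}

/-- One update of the opinion profile `x` with weighting factor `μ` and confidence bounds `r`,
when the pair `p = {i, j}` is selected: agent `i` moves towards `j` iff their opinions differ by
at most `r i`, agent `j` moves towards `i` iff they differ by at most `r j`, all others stay. -/
noncomputable def step {n : ℕ} (μ : ℝ) (r : Fin n → ℝ) (p : AgentPair n) (x : Fin n → ℝ) :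
    Fin n → ℝ :=
  let i := p.1.1
  let j := p.1.2
  fun k =>
    if k = i then x i + μ * (if |x j - x i| ≤ r i then 1 else 0) * (x j - x i)
    else if k = j then x j + μ * (if |x j - x i| ≤ r j then 1 else 0) * (x i - x j)
    else x k

/-- The opinion profile at time `t`, started from `x₀`, along the sequence `ω` of selected
pairs. -/
noncomputable def opinions {n : ℕ} (μ : ℝ) (r : Fin n → ℝ) (x₀ : Fin n → ℝ)
    (ω : ℕ → AgentPair n) : ℕ → Fin n → ℝ
  | 0 => x₀
  | t + 1 => step μ r (ω t) (opinions μ r x₀ ω t)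

/-- The law of the sequence of selected pairs: the pairs are independent and each of them is
uniformly distributed on the set of all pairs. -/
noncomputable def pathMeasure (n : ℕ) : Measure (ℕ → AgentPair n) :=
  Measure.infinitePi fun _ : ℕ => uniformOn (Set.univ : Set (AgentPair n))

/-- Consensus: all agents' opinions converge to the same value. -/
def ReachesConsensus {n : ℕ} (x : ℕ → Fin n → ℝ) : Prop :=
  ∃ c : ℝ, ∀ i : Fin n, Tendsto (fun t => x t i) atTop (𝓝 c)

/-- With at least two agents the uniform law on pairs is a probability measure. -/
theorem isProbabilityMeasure_uniformOn_pair {n : ℕ} (hn : 2 ≤ n) :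
    IsProbabilityMeasure (uniformOn (Set.univ : Set (AgentPair n))) :=
  isProbabilityMeasure_uniformOn Set.finite_univ
    ⟨⟨(⟨0, by omega⟩, ⟨1, by omega⟩), by simp⟩, Set.mem_univ _⟩

/-- With at least two agents the law of the sequence of pairs is a probability measure. -/
theorem isProbabilityMeasure_pathMeasure {n : ℕ} (hn : 2 ≤ n) :
    IsProbabilityMeasure (pathMeasure n) := by
  have := isProbabilityMeasure_uniformOn_pair hn
  unfold pathMeasure
  infer_instance

end DW

/-! Agent `0` has a confidence bound at least the diameter of the opinions, so it listens to
everyone it meets. If an agent `i` ignores agent `0` at a meeting, their gap shrinks by the factor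
`1 - μ`; after boundedly many meetings in a row it is at most `r i`, and `i` listens. Thus agent `0`
can drag everybody.

In an interval `[a, b]` of length at most 1, if some opinion lies in the lower half, one tour of
meetings brings agent `0` a definite distance below `b` (`run_tour_zero_le`), and a second brings
everyone there (`run_tour_le`). Otherwise the upper half already contains all opinions. One fixed
word therefore contracts every such interval by a constant factor `c < 1`. By the second
Borel–Cantelli lemma this word occurs infinitely often almost surely, and the diameter tends to 0.
Fubini covers random initial states. -/

namespace DW

open MeasureTheory ProbabilityTheory Filter Topology

/-! ### Convexity of the updates -/

section Dynamics

variable {n : ℕ} {μ : ℝ} {r : Fin n → ℝ}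

/-- The opinion profile after the pairs in the list `l` have been selected one after another. -/
noncomputable def run (μ : ℝ) (r : Fin n → ℝ) (l : List (AgentPair n)) (x : Fin n → ℝ) :
    Fin n → ℝ :=
  l.foldl (fun y p => step μ r p y) x

theorem run_cons (p : AgentPair n) (l : List (AgentPair n)) (x : Fin n → ℝ) :
    run μ r (p :: l) x = run μ r l (step μ r p x) := rfl

theorem run_append (l₁ l₂ : List (AgentPair n)) (x : Fin n → ℝ) :
    run μ r (l₁ ++ l₂) x = run μ r l₂ (run μ r l₁ x) := by
  simp [run]

/-- An agent either keeps its opinion or moves by the fraction `μ` towards another agent. -/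
theorem step_apply_eq (p : AgentPair n) (x : Fin n → ℝ) (k : Fin n) :
    step μ r p x k = x k ∨ ∃ l, step μ r p x k = (1 - μ) * x k + μ * x l := by
  obtain ⟨⟨i, j⟩, hij⟩ := p
  simp only [step]
  split_ifs with h₁ h₂ h₃ h₄
  · right; exact ⟨j, by rw [h₁]; ring⟩
  · left; rw [h₁]; ring
  · right; exact ⟨i, by rw [h₃]; ring⟩
  · left; rw [h₃]; ring
  · left; rfl

/-- An update is a convex combination in which an agent keeps weight at least `1 - μ` on itself, so
a gap `g` below the ceiling `b` loses at most that factor. -/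
theorem step_le (h₀ : 0 ≤ μ) (h₁ : μ ≤ 1) {b g : ℝ} (hg : 0 ≤ g) {x : Fin n → ℝ}
    (hb : ∀ i, x i ≤ b) (p : AgentPair n) {k : Fin n} (hk : x k ≤ b - g) :
    step μ r p x k ≤ b - (1 - μ) * g := by
  rcases step_apply_eq (μ := μ) (r := r) p x k with h | ⟨l, h⟩
  · rw [h]; nlinarith
  · rw [h]; nlinarith [hb l]

theorem step_mem_Icc (h₀ : 0 ≤ μ) (h₁ : μ ≤ 1) {a b : ℝ} {x : Fin n → ℝ}
    (hx : ∀ i, x i ∈ Set.Icc a b) (p : AgentPair n) (k : Fin n) :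
    step μ r p x k ∈ Set.Icc a b := by
  rcases step_apply_eq (μ := μ) (r := r) p x k with h | ⟨l, h⟩
  · rw [h]; exact hx k
  · rw [h]
    have := hx k
    have := hx l
    simp only [Set.mem_Icc] at *
    constructor <;> nlinarith

theorem run_mem_Icc (h₀ : 0 ≤ μ) (h₁ : μ ≤ 1) {a b : ℝ} (l : List (AgentPair n))
    {x : Fin n → ℝ} (hx : ∀ i, x i ∈ Set.Icc a b) (k : Fin n) :
    run μ r l x k ∈ Set.Icc a b := by
  induction l generalizing x with
  | nil => exact hx k
  | cons p l ih => exact ih (step_mem_Icc h₀ h₁ hx p)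

theorem run_le (h₀ : 0 ≤ μ) (h₁ : μ ≤ 1) {b g : ℝ} (hg : 0 ≤ g) (l : List (AgentPair n))
    {x : Fin n → ℝ} (hb : ∀ i, x i ≤ b) {k : Fin n} (hk : x k ≤ b - g) :
    run μ r l x k ≤ b - (1 - μ) ^ l.length * g := by
  induction l generalizing x g with
  | nil => simpa [run] using hk
  | cons p l ih =>
    have hb' : ∀ i, step μ r p x i ≤ b := fun i => by
      simpa using step_le (r := r) h₀ h₁ le_rfl hb p (by simpa using hb i)
    have := ih (mul_nonneg (by linarith) hg) hb' (step_le h₀ h₁ hg hb p hk)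
    rw [run_cons, List.length_cons, pow_succ, mul_assoc]
    exact this

end Dynamics

/-! ### A contracting word led by agent `0` -/

section Contraction

variable {m : ℕ} {μ : ℝ} {r : Fin (m + 1) → ℝ}

/-- The pair formed by the agent `0` and another agent. -/
def leaderPair (i : Fin m) : AgentPair (m + 1) := ⟨(0, i.succ), i.succ_pos⟩

theorem step_leaderPair_zero {x : Fin (m + 1) → ℝ} {i : Fin m} (h : |x i.succ - x 0| ≤ r 0) :
    step μ r (leaderPair i) x 0 = (1 - μ) * x 0 + μ * x i.succ := by
  simp only [step, leaderPair, if_true, h]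
  ring

theorem step_leaderPair_succ_of_le {x : Fin (m + 1) → ℝ} {i : Fin m}
    (h : |x i.succ - x 0| ≤ r i.succ) :
    step μ r (leaderPair i) x i.succ = (1 - μ) * x i.succ + μ * x 0 := by
  simp only [step, leaderPair, if_true, h, Fin.succ_ne_zero, if_false]
  ring

theorem step_leaderPair_succ_of_not_le {x : Fin (m + 1) → ℝ} {i : Fin m}
    (h : ¬ |x i.succ - x 0| ≤ r i.succ) :
    step μ r (leaderPair i) x i.succ = x i.succ := by
  simp only [step, leaderPair, if_true, h, Fin.succ_ne_zero, if_false]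
  ring

theorem abs_sub_le_of_mem_Icc {a b y z : ℝ} (hy : y ∈ Set.Icc a b) (hz : z ∈ Set.Icc a b) :
    |y - z| ≤ b - a := by
  rw [abs_le]
  simp only [Set.mem_Icc] at *
  constructor <;> linarith

/-- Selecting the pair of agent `0` and another agent often enough pulls the other agent away
from an upper bound of all opinions if agent `0` is away from it. -/
theorem run_replicate_leaderPair_le (h₀ : 0 ≤ μ) (h₁ : μ ≤ 1) {a b g : ℝ} (hab : b - a ≤ r 0)
    (hg : 0 ≤ g) (i : Fin m) (M : ℕ) {x : Fin (m + 1) → ℝ} (hx : ∀ k, x k ∈ Set.Icc a b)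
    (h0 : x 0 ≤ b - g) (hM : (1 - μ) ^ M * |x i.succ - x 0| ≤ r i.succ) :
    run μ r (List.replicate (M + 1) (leaderPair i)) x i.succ ≤ b - (1 - μ) ^ M * (μ * g) := by
  -- If `i` listens at the first meeting it gains the gap `μ * g`; the other `M` meetings cost at
  -- most `1 - μ` each.
  have key : ∀ (M : ℕ) {x : Fin (m + 1) → ℝ} {g : ℝ}, 0 ≤ g → (∀ k, x k ∈ Set.Icc a b) →
      x 0 ≤ b - g → |x i.succ - x 0| ≤ r i.succ →
      run μ r (List.replicate (M + 1) (leaderPair i)) x i.succ ≤ b - (1 - μ) ^ M * (μ * g) := by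
    intro M x g hg hx h0 h
    have := run_le (r := r) h₀ h₁ (mul_nonneg h₀ hg) (List.replicate M (leaderPair i))
      (fun k => (step_mem_Icc (r := r) h₀ h₁ hx (leaderPair i) k).2) (k := i.succ) (by
        rw [step_leaderPair_succ_of_le h]
        nlinarith [(hx i.succ).2])
    rwa [List.length_replicate] at this
  induction M generalizing x g with
  | zero => exact key 0 hg hx h0 (by simpa using hM)
  | succ M ih =>
    by_cases h : |x i.succ - x 0| ≤ r i.succ
    · exact key _ hg hx h0 h
    -- Only agent `0` moves here: the distance to `i` shrinks by `1 - μ`, which pays for one unit of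
    -- `M`.
    · have hd : |x i.succ - x 0| ≤ r 0 := (abs_sub_le_of_mem_Icc (hx _) (hx _)).trans hab
      have hx' := step_mem_Icc (r := r) h₀ h₁ hx (leaderPair i)
      have e₀ := step_leaderPair_zero (μ := μ) hd
      have e₁ := step_leaderPair_succ_of_not_le (μ := μ) h
      have hg' : 0 ≤ (1 - μ) * g := mul_nonneg (by linarith) hg
      have e : |step μ r (leaderPair i) x i.succ - step μ r (leaderPair i) x 0|
          = (1 - μ) * |x i.succ - x 0| := by
        rw [e₀, e₁, ← abs_of_nonneg (show 0 ≤ 1 - μ by linarith), ← abs_mul,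
          abs_of_nonneg (show 0 ≤ 1 - μ by linarith)]
        congr 1; ring
      have := ih hg' hx' (step_le h₀ h₁ hg (fun k => (hx k).2) _ h0)
        (by rw [e, ← mul_assoc, ← pow_succ]; exact hM)
      rw [List.replicate_succ, run_cons]
      refine this.trans (le_of_eq ?_)
      ring

/-- The word in which agent `0` meets each other agent `M + 1` times in a row. -/
def tour (m M : ℕ) : List (AgentPair (m + 1)) :=
  (List.finRange m).flatMap fun i => List.replicate (M + 1) (leaderPair i)

theorem exists_tour_eq (M : ℕ) (i : Fin m) :
    ∃ l₁ l₂, tour m M = l₁ ++ (List.replicate (M + 1) (leaderPair i) ++ l₂) := by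
  obtain ⟨s, t, h⟩ := List.append_of_mem (List.mem_finRange i)
  exact ⟨s.flatMap fun i => List.replicate (M + 1) (leaderPair i),
    t.flatMap fun i => List.replicate (M + 1) (leaderPair i), by simp [tour, h]⟩

/-- The tour makes agent `0` meet agent `k`, and it listens, inheriting `μ` times the gap that `k`
has left. -/
theorem run_tour_zero_le (h₀ : 0 ≤ μ) (h₁ : μ ≤ 1) {a b g : ℝ} (hab : b - a ≤ r 0)
    (hg : 0 ≤ g) (M : ℕ) {x : Fin (m + 1) → ℝ} (hx : ∀ k, x k ∈ Set.Icc a b)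
    {k : Fin (m + 1)} (hk : x k ≤ b - g) :
    run μ r (tour m M) x 0 ≤ b - (1 - μ) ^ (tour m M).length * (μ * g) := by
  have hq : 0 ≤ 1 - μ := by linarith
  rcases Fin.eq_zero_or_eq_succ k with rfl | ⟨i, rfl⟩
  · exact run_le h₀ h₁ (mul_nonneg h₀ hg) _ (fun k => (hx k).2) (by nlinarith)
  · obtain ⟨l₁, l₂, h⟩ := exists_tour_eq M i
    rw [List.replicate_succ, List.cons_append] at h
    rw [h, run_append, run_cons]
    have hx' := run_mem_Icc (r := r) h₀ h₁ l₁ hx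
    have hg' : 0 ≤ (1 - μ) ^ l₁.length * g := by positivity
    have hi := run_le (r := r) h₀ h₁ hg l₁ (fun k => (hx k).2) hk
    have := run_le (r := r) h₀ h₁ (mul_nonneg h₀ hg')
      (List.replicate M (leaderPair i) ++ l₂)
      (fun k => (step_mem_Icc (r := r) h₀ h₁ hx' (leaderPair i) k).2) (k := 0) (by
        rw [step_leaderPair_zero ((abs_sub_le_of_mem_Icc (hx' _) (hx' _)).trans hab)]
        nlinarith [(hx' 0).2])
    refine this.trans ?_
    have hp : (1 - μ) ^ (l₁ ++ leaderPair i :: (List.replicate M (leaderPair i) ++ l₂)).length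
        ≤ (1 - μ) ^ ((List.replicate M (leaderPair i) ++ l₂).length + l₁.length) :=
      pow_le_pow_of_le_one hq (by linarith) (by simp; omega)
    have := mul_le_mul_of_nonneg_right hp (mul_nonneg h₀ hg)
    rw [pow_add] at this
    nlinarith

theorem run_tour_le (h₀ : 0 ≤ μ) (h₁ : μ ≤ 1) {a b g : ℝ} (hab : b - a ≤ r 0)
    (hg : 0 ≤ g) {M : ℕ} (hM : ∀ k, (1 - μ) ^ M * (b - a) ≤ r k) {x : Fin (m + 1) → ℝ}
    (hx : ∀ k, x k ∈ Set.Icc a b) (h0 : x 0 ≤ b - g) (k : Fin (m + 1)) :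
    run μ r (tour m M) x k ≤ b - (1 - μ) ^ (tour m M).length * (μ * g) := by
  have hq : 0 ≤ 1 - μ := by linarith
  rcases Fin.eq_zero_or_eq_succ k with rfl | ⟨i, rfl⟩
  · exact run_le h₀ h₁ (mul_nonneg h₀ hg) _ (fun k => (hx k).2) (by nlinarith)
  · obtain ⟨l₁, l₂, h⟩ := exists_tour_eq M i
    rw [h, run_append, run_append]
    have hx₁ := run_mem_Icc (r := r) h₀ h₁ l₁ hx
    have hx₂ := run_mem_Icc (r := r) h₀ h₁ (List.replicate (M + 1) (leaderPair i)) hx₁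
    have hg₁ : 0 ≤ (1 - μ) ^ l₁.length * g := by positivity
    have hi := run_replicate_leaderPair_le h₀ h₁ hab hg₁ i M hx₁
      (run_le (r := r) h₀ h₁ hg l₁ (fun k => (hx k).2) h0)
      ((mul_le_mul_of_nonneg_left (abs_sub_le_of_mem_Icc (hx₁ _) (hx₁ _))
        (pow_nonneg hq M)).trans (hM _))
    refine (run_le (r := r) h₀ h₁ (by positivity) l₂ (fun k => (hx₂ k).2) hi).trans ?_
    have hp : (1 - μ) ^ (l₁ ++ (List.replicate (M + 1) (leaderPair i) ++ l₂)).length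
        ≤ (1 - μ) ^ (l₂.length + (M + l₁.length)) :=
      pow_le_pow_of_le_one hq (by linarith) (by simp; omega)
    have := mul_le_mul_of_nonneg_right hp (mul_nonneg h₀ hg)
    rw [pow_add, pow_add] at this
    nlinarith

/-- There is a word that shrinks every short enough interval containing all opinions by a
constant factor. -/
theorem exists_contracting_word (h₀ : 0 < μ) (h₁ : μ < 1) (hr : ∀ k, 0 < r k)
    (hr0 : 1 ≤ r 0) :
    ∃ (w : List (AgentPair (m + 1))) (c : ℝ), 0 ≤ c ∧ c < 1 ∧
      ∀ (x : Fin (m + 1) → ℝ) (a b : ℝ), a ≤ b → b - a ≤ 1 → (∀ k, x k ∈ Set.Icc a b) →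
        ∃ a' b', a' ≤ b' ∧ b' - a' ≤ c * (b - a) ∧ ∀ k, run μ r w x k ∈ Set.Icc a' b' := by
  have hq : 0 < 1 - μ := by linarith
  obtain ⟨M, hM⟩ : ∃ M : ℕ, ∀ k, (1 - μ) ^ M ≤ r k := by
    have : ∀ᶠ M : ℕ in atTop, ∀ k, (1 - μ) ^ M ≤ r k := by
      rw [eventually_all]
      intro k
      exact ((tendsto_pow_atTop_nhds_zero_of_lt_one hq.le (by linarith)).eventually_lt_const
        (hr k)).mono fun _ h => h.le
    exact this.exists
  set e : ℝ := (1 - μ) ^ (tour m M).length with he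
  have he0 : 0 < e := by positivity
  have he1 : e ≤ 1 := pow_le_one₀ hq.le (by linarith)
  have hd0 : 0 < e * (μ * (e * (μ * (1 / 2)))) := by positivity
  -- The bound `1 / 2` gives `c ≥ 1 / 2`, so halving the interval also counts as contraction by `c`.
  have hd1 : e * (μ * (e * (μ * (1 / 2)))) ≤ 1 / 2 := by
    have h2 : e * μ ≤ 1 := mul_le_one₀ he1 h₀.le h₁.le
    have h3 : 0 ≤ e * μ := by positivity
    nlinarith
  refine ⟨tour m M ++ tour m M, 1 - e * (μ * (e * (μ * (1 / 2)))), by linarith, by linarith, ?_⟩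
  intro x a b hab hab1 hx
  by_cases h : ∃ k, x k ≤ b - (b - a) / 2
  · obtain ⟨k, hk⟩ := h
    have hx' := run_mem_Icc (r := r) h₀.le h₁.le (tour m M) hx
    have hg : 0 ≤ (b - a) / 2 := by linarith
    have hz := run_tour_zero_le h₀.le h₁.le (hab1.trans hr0) hg M hx hk
    have hall := run_tour_le h₀.le h₁.le (hab1.trans hr0) (by positivity)
      (fun k => (mul_le_of_le_one_right (pow_nonneg hq.le M) hab1).trans (hM k)) hx' hz
    refine ⟨a, b - e * (μ * (e * (μ * ((b - a) / 2)))), ?_, le_of_eq (by ring), fun k => ?_⟩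
    · nlinarith
    · rw [run_append]
      exact ⟨(run_mem_Icc (r := r) h₀.le h₁.le (tour m M) hx' k).1, hall k⟩
  -- The initial opinions all lie in the upper half, and convexity keeps them there.
  · push Not at h
    refine ⟨b - (b - a) / 2, b, by linarith, by nlinarith, ?_⟩
    exact run_mem_Icc h₀.le h₁.le _ fun k => ⟨(h k).le, (hx k).2⟩

end Contraction

/-! ### From recurring contraction to consensus -/

section Consensus

variable {n : ℕ} {μ : ℝ} {r : Fin n → ℝ}

/-- The word `w` is selected starting at time `t`. -/
def OccursAt (w : List (AgentPair n)) (ω : ℕ → AgentPair n) (t : ℕ) : Prop :=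
  ∀ s (hs : s < w.length), ω (t + s) = w[s]

theorem opinions_add_length (x₀ : Fin n → ℝ) (ω : ℕ → AgentPair n) (w : List (AgentPair n))
    (t : ℕ) (h : OccursAt w ω t) :
    opinions μ r x₀ ω (t + w.length) = run μ r w (opinions μ r x₀ ω t) := by
  induction w generalizing t with
  | nil => rfl
  | cons p l ih =>
    have hp : ω t = p := h 0 (by simp)
    have hl : OccursAt l ω (t + 1) := fun s hs => by
      have := h (s + 1) (by simpa using hs)
      simpa [add_assoc, add_comm 1 s] using this
    have := ih (t + 1) hl
    rw [run_cons, ← hp, List.length_cons, ← add_assoc, add_right_comm]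
    exact this

theorem opinions_mem_Icc_of_le (h₀ : 0 ≤ μ) (h₁ : μ ≤ 1) {x₀ : Fin n → ℝ}
    {ω : ℕ → AgentPair n} {a b : ℝ} {t : ℕ} (h : ∀ k, opinions μ r x₀ ω t k ∈ Set.Icc a b)
    {s : ℕ} (hs : t ≤ s) (k : Fin n) : opinions μ r x₀ ω s k ∈ Set.Icc a b := by
  induction s, hs using Nat.le_induction generalizing k with
  | base => exact h k
  | succ s _ ih => exact step_mem_Icc h₀ h₁ ih _ k

theorem reachesConsensus_of_intervals (hn : 0 < n) {x : ℕ → Fin n → ℝ}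
    (h : ∀ ε > 0, ∃ (T : ℕ) (a b : ℝ), b - a < ε ∧ ∀ t ≥ T, ∀ k, x t k ∈ Set.Icc a b) :
    ReachesConsensus x := by
  have hc : CauchySeq fun t => x t ⟨0, hn⟩ := by
    rw [Metric.cauchySeq_iff]
    intro ε hε
    obtain ⟨T, a, b, hab, hT⟩ := h ε hε
    exact ⟨T, fun s hs t ht =>
      (abs_sub_le_of_mem_Icc (hT s hs _) (hT t ht _)).trans_lt hab⟩
  obtain ⟨c, hc⟩ := cauchySeq_tendsto_of_complete hc
  refine ⟨c, fun i => ?_⟩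
  have hd : Tendsto (fun t => x t i - x t ⟨0, hn⟩) atTop (𝓝 0) := by
    rw [Metric.tendsto_atTop]
    intro ε hε
    obtain ⟨T, a, b, hab, hT⟩ := h ε hε
    refine ⟨T, fun t ht => ?_⟩
    rw [Real.dist_eq, sub_zero]
    exact (abs_sub_le_of_mem_Icc (hT t ht _) (hT t ht _)).trans_lt hab
  simpa using hd.add hc

theorem reachesConsensus_of_contracting_word (hn : 0 < n) (h₀ : 0 ≤ μ) (h₁ : μ ≤ 1)
    {w : List (AgentPair n)} {c : ℝ} (hc0 : 0 ≤ c) (hc1 : c < 1)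
    (hw : ∀ (x : Fin n → ℝ) (a b : ℝ), a ≤ b → b - a ≤ 1 → (∀ k, x k ∈ Set.Icc a b) →
        ∃ a' b', a' ≤ b' ∧ b' - a' ≤ c * (b - a) ∧ ∀ k, run μ r w x k ∈ Set.Icc a' b')
    {x₀ : Fin n → ℝ} (hx₀ : ∀ i, x₀ i ∈ Set.Icc (0 : ℝ) 1) {ω : ℕ → AgentPair n}
    (hω : ∃ᶠ t in atTop, OccursAt w ω t) : ReachesConsensus (opinions μ r x₀ ω) := by
  have key : ∀ k : ℕ, ∃ (T : ℕ) (a b : ℝ), a ≤ b ∧ b - a ≤ c ^ k ∧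
      ∀ i, opinions μ r x₀ ω T i ∈ Set.Icc a b := by
    intro k
    induction k with
    | zero => exact ⟨0, 0, 1, by norm_num, by norm_num, hx₀⟩
    | succ k ih =>
      obtain ⟨T, a, b, hab, hk, hT⟩ := ih
      obtain ⟨t, ht, hocc⟩ := frequently_atTop.1 hω T
      obtain ⟨a', b', hab', hd, hin⟩ := hw (opinions μ r x₀ ω t) a b hab
        (hk.trans (pow_le_one₀ hc0 hc1.le)) (opinions_mem_Icc_of_le h₀ h₁ hT ht)
      refine ⟨t + w.length, a', b', hab', hd.trans ?_, fun i => ?_⟩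
      · rw [pow_succ']
        exact mul_le_mul_of_nonneg_left hk hc0
      · rw [opinions_add_length _ _ _ _ hocc]
        exact hin i
  refine reachesConsensus_of_intervals hn fun ε hε => ?_
  obtain ⟨k, hk⟩ := exists_pow_lt_of_lt_one hε hc1
  obtain ⟨T, a, b, -, hd, hT⟩ := key k
  exact ⟨T, a, b, hd.trans_lt hk, fun t ht => opinions_mem_Icc_of_le h₀ h₁ hT ht⟩

end Consensus

/-! ### Recurrence of words and measurability -/

section Probability

variable {n : ℕ}

theorem uniformOn_univ_singleton (p : AgentPair n) :
    uniformOn (Set.univ : Set (AgentPair n)) {p} = (Fintype.card (AgentPair n) : ENNReal)⁻¹ := by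
  rw [uniformOn_univ, Measure.count_singleton, one_div]

theorem pathMeasure_pi_singleton (hn : 2 ≤ n) (s : Finset ℕ) (v : ℕ → AgentPair n) :
    pathMeasure n (Set.pi s fun t => {v t})
      = (Fintype.card (AgentPair n) : ENNReal)⁻¹ ^ s.card := by
  have := isProbabilityMeasure_uniformOn_pair hn
  rw [pathMeasure, Measure.infinitePi_pi _ fun _ _ => measurableSet_singleton _,
    Finset.prod_congr rfl fun t _ => uniformOn_univ_singleton (v t), Finset.prod_const]

/-- Almost surely every given word is selected infinitely often. -/
theorem ae_frequently_occursAt (hn : 2 ≤ n) (w : List (AgentPair n)) :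
    ∀ᵐ ω ∂pathMeasure n, ∃ᶠ t in atTop, OccursAt w ω t := by
  have := isProbabilityMeasure_pathMeasure hn
  rcases Nat.eq_zero_or_pos w.length with hw | hw
  · exact .of_forall fun ω => Frequently.of_forall fun t s hs => by omega
  set K := w.length with hK
  -- Time is cut into disjoint blocks of length `K`; `A k` says that block `k` spells `w`.
  -- Disjointness gives independence.
  let v : ℕ → AgentPair n := fun t => w[t % K]'(Nat.mod_lt _ hw)
  let I : ℕ → Finset ℕ := fun k => Finset.Ico (k * K) (k * K + K)
  let A : ℕ → Set (ℕ → AgentPair n) := fun k => Set.pi (I k) fun t => {v t}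
  have hdisj : Pairwise fun k l => Disjoint (I k) (I l) := by
    intro k l hkl
    rw [Finset.disjoint_left]
    intro t hk hl
    simp only [I, Finset.mem_Ico] at hk hl
    have e : ∀ j, j * K ≤ t ∧ t < j * K + K → t / K = j := fun j hj =>
      Nat.div_eq_of_lt_le hj.1 (by rw [Nat.succ_mul]; exact hj.2)
    exact hkl ((e k hk).symm.trans (e l hl))
  have hAm : ∀ k, MeasurableSet (A k) := fun k =>
    MeasurableSet.pi (Finset.countable_toSet _) fun _ _ => measurableSet_singleton _
  have hAmeas : ∀ k, pathMeasure n (A k) = (Fintype.card (AgentPair n) : ENNReal)⁻¹ ^ K := by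
    intro k
    rw [pathMeasure_pi_singleton hn]
    simp [I]
  have hind : iIndepSet A (pathMeasure n) := by
    rw [iIndepSet_iff_meas_biInter hAm]
    intro S
    have hS : (⋂ k ∈ S, A k) = Set.pi (S.biUnion I : Finset ℕ) fun t => {v t} := by
      ext ω
      simp only [A, Set.mem_iInter, Set.mem_pi, Finset.coe_biUnion, Set.mem_iUnion]
      exact ⟨fun h t ⟨k, hk, ht⟩ => h k hk t ht, fun h k hk t ht => h t ⟨k, hk, ht⟩⟩
    rw [hS, pathMeasure_pi_singleton hn, Finset.prod_congr rfl fun k _ => hAmeas k,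
      Finset.card_biUnion fun k _ l _ hkl => hdisj hkl]
    simp [I, pow_mul, pow_right_comm]
  have hsum : ∑' k, pathMeasure n (A k) = ⊤ := by
    simp_rw [hAmeas]
    exact ENNReal.tsum_const_eq_top_of_ne_zero (by simp)
  have hlim := measure_limsup_eq_one hAm hind hsum
  have hlim' : ∀ᵐ ω ∂pathMeasure n, ω ∈ limsup A atTop :=
    (prob_compl_eq_zero_iff (MeasurableSet.measurableSet_limsup hAm)).2 hlim
  filter_upwards [hlim'] with ω hω
  rw [mem_limsup_iff_frequently_mem] at hω
  refine (tendsto_id.atTop_mul_const' hw).frequently (hω.mono fun k hk s hs => ?_)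
  have hmod : (k * K + s) % K = s := by rw [Nat.mul_add_mod_self_right, Nat.mod_eq_of_lt hs]
  have : ω (k * K + s) = v (k * K + s) := hk _ (by simp [I, hK, hs])
  simpa only [v, hmod, id] using this

theorem ae_reachesConsensus (hn : 2 ≤ n) {μ : ℝ} (h₀ : 0 < μ) (h₁ : μ < 1) {r : Fin n → ℝ}
    (hr : ∀ i, 0 < r i) (hr0 : 1 ≤ r ⟨0, by omega⟩) {x₀ : Fin n → ℝ}
    (hx₀ : ∀ i, x₀ i ∈ Set.Icc (0 : ℝ) 1) :
    ∀ᵐ ω ∂pathMeasure n, ReachesConsensus (opinions μ r x₀ ω) := by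
  obtain ⟨m, rfl⟩ : ∃ m, n = m + 1 := ⟨n - 1, by omega⟩
  obtain ⟨w, c, hc0, hc1, hw⟩ := exists_contracting_word h₀ h₁ hr hr0
  filter_upwards [ae_frequently_occursAt hn w] with ω hω
  exact reachesConsensus_of_contracting_word (by omega) h₀.le h₁.le hc0 hc1 hw hx₀ hω

theorem measurable_step (μ : ℝ) (r : Fin n → ℝ) (p : AgentPair n) :
    Measurable (step μ r p) := by
  refine measurable_pi_lambda _ fun k => ?_
  have hset : ∀ l, MeasurableSet {x : Fin n → ℝ | |x p.1.2 - x p.1.1| ≤ r l} := fun l =>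
    measurableSet_le (by fun_prop) (by fun_prop)
  have hind : ∀ l, Measurable fun x : Fin n → ℝ =>
      if |x p.1.2 - x p.1.1| ≤ r l then (1 : ℝ) else 0 := fun l =>
    Measurable.ite (hset l) measurable_const measurable_const
  have h₁ := hind p.1.1
  have h₂ := hind p.1.2
  simp only [step]
  split_ifs
  · fun_prop
  · fun_prop
  · fun_prop

theorem measurable_opinions (μ : ℝ) (r : Fin n → ℝ) (t : ℕ) :
    Measurable fun z : (Fin n → ℝ) × (ℕ → AgentPair n) => opinions μ r z.1 z.2 t := by
  induction t with
  | zero => exact measurable_fst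
  | succ t ih =>
    have h : Measurable fun q : (Fin n → ℝ) × AgentPair n => step μ r q.2 q.1 :=
      measurable_from_prod_countable_left (measurable_step μ r)
    exact h.comp (ih.prodMk ((measurable_pi_apply t).comp measurable_snd))

/-- Separates the existence of a limit from the countably many conditions that are visibly
measurable. -/
theorem reachesConsensus_iff (hn : 0 < n) (x : ℕ → Fin n → ℝ) :
    ReachesConsensus x ↔ (∃ c, Tendsto (fun t => x t ⟨0, hn⟩) atTop (𝓝 c)) ∧
      ∀ i, Tendsto (fun t => x t i - x t ⟨0, hn⟩) atTop (𝓝 0) := by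
  constructor
  · rintro ⟨c, hc⟩
    exact ⟨⟨c, hc _⟩, fun i => by simpa using (hc i).sub (hc ⟨0, hn⟩)⟩
  · rintro ⟨⟨c, hc⟩, h⟩
    exact ⟨c, fun i => by simpa using (h i).add hc⟩

theorem measurableSet_reachesConsensus (hn : 0 < n) (μ : ℝ) (r : Fin n → ℝ) :
    MeasurableSet {z : (Fin n → ℝ) × (ℕ → AgentPair n) |
      ReachesConsensus (opinions μ r z.1 z.2)} := by
  have hm : ∀ t i, Measurable fun z : (Fin n → ℝ) × (ℕ → AgentPair n) =>
      opinions μ r z.1 z.2 t i := fun t i =>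
    (measurable_pi_apply i).comp (measurable_opinions μ r t)
  simp only [reachesConsensus_iff hn, Set.ofPred_and, Set.ofPred_forall]
  refine MeasurableSet.inter (measurableSet_exists_tendsto fun t => hm t _)
    (MeasurableSet.iInter fun i => ?_)
  exact measurableSet_tendsto (𝓝 0) fun t => (hm t i).sub (hm t _)

end Probability

end DW

theorem corollary1 (n : ℕ) (hn : 3 ≤ n) (μ : ℝ) (hμ : μ ∈ Set.Ico (1 / 2 : ℝ) 1)
    (r : Fin n → ℝ) (hr_pos : ∀ i, 0 < r i) (hr_anti : Antitone r)
    (hr_large : 1 ≤ r ⟨0, by omega⟩) :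
    (∀ x₀ : Fin n → ℝ, (∀ i, x₀ i ∈ Set.Icc (0 : ℝ) 1) →
      ∀ᵐ ω ∂(DW.pathMeasure n), DW.ReachesConsensus (DW.opinions μ r x₀ ω)) ∧
    (∀ ν : MeasureTheory.Measure (Fin n → ℝ), MeasureTheory.IsProbabilityMeasure ν →
      (∀ᵐ x₀ ∂ν, ∀ i, x₀ i ∈ Set.Icc (0 : ℝ) 1) →
      ∀ᵐ z ∂(ν.prod (DW.pathMeasure n)), DW.ReachesConsensus (DW.opinions μ r z.1 z.2)) := by
  have h₀ : 0 < μ := lt_of_lt_of_le (by norm_num) hμ.1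
  have hdet : ∀ x₀ : Fin n → ℝ, (∀ i, x₀ i ∈ Set.Icc (0 : ℝ) 1) →
      ∀ᵐ ω ∂(DW.pathMeasure n), DW.ReachesConsensus (DW.opinions μ r x₀ ω) := fun x₀ hx₀ =>
    DW.ae_reachesConsensus (by omega) h₀ hμ.2 hr_pos hr_large hx₀
  refine ⟨hdet, fun ν hν hx => ?_⟩
  have := DW.isProbabilityMeasure_pathMeasure (n := n) (by omega)
  have hmeas := DW.measurableSet_reachesConsensus (n := n) (by omega) μ r
  exact (MeasureTheory.Measure.ae_prod_iff_ae_ae hmeas).2 (hx.mono hdet)
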